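/- All graphs are finite and simple. For positive integers $s$ and $t$, let $K_s + I_t$ denote the graph obtained from the disjoint union of a complete graph on $s$ vertices and an edgeless graph on $t$ vertices by joining every vertex of the first to every vertex of the second. A subdivision of a graph $H$ is a graph obtained from $H$ by replacing its edges with pairwise internally disjoint paths (each of length at least $1$) whose internal vertices are new. For integers $k, d \ge 0$, a graph $G$ is $k$-colorable with defect $d$ if there is a map $\alpha : V(G) \to \{1,\dots,k\}$ such that for every color $i$ the subgraph of $G$ induced by $\alpha^{-1}(\{i\})$ has maximum degree at most $d$. For all positive integers $s$ and $t$ there is an integer $N = N(s,t) \ge 0$ such that every graph $G$ that has no subgraph which is both bipartite and a subdivision of $K_s + I_t$ is $s$-colorable with defect $N$. -/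

import Mathlib

namespace SimpleGraph

/-- The join of two graphs: their disjoint union together with all edges between them. -/
def joinGraph {V W : Type*} (G : SimpleGraph V) (H : SimpleGraph W) : SimpleGraph (V ⊕ W) :=
  (G ⊕g H) ⊔ completeBipartiteGraph V W

/-- The graph `K_s + I_t`: the join of a complete graph on `s` vertices and an edgeless graph
on `t` vertices. -/
def completeJoinEmpty (s t : ℕ) : SimpleGraph (Fin s ⊕ Fin t) :=
  joinGraph (⊤ : SimpleGraph (Fin s)) (⊥ : SimpleGraph (Fin t))

/-- `S` is presented as a subdivision of `H`: it is obtained from `H` by replacing the edges of `H`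
by pairwise internally disjoint linking paths. The linking path of an edge is recorded for both of
its orientations, and the two records are reverses of each other. -/
structure SubdivisionModel {W U : Type*} (H : SimpleGraph W) (S : SimpleGraph U) where
  /-- The branch vertex that corresponds to a vertex of `H`. -/
  branch : W ↪ U
  /-- The linking path of an (oriented) edge of `H`. -/
  link : ∀ {a b : W}, H.Adj a b → S.Walk (branch a) (branch b)
  link_isPath : ∀ {a b : W} (h : H.Adj a b), (link h).IsPath
  link_symm : ∀ {a b : W} (h : H.Adj a b), link h.symm = (link h).reverse
  /-- A linking path meets the branch vertices only in its two ends. -/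
  branch_mem_link : ∀ {a b : W} (h : H.Adj a b) (c : W),
    branch c ∈ (link h).support → c = a ∨ c = b
  /-- Linking paths of distinct edges have no common vertex other than branch vertices. -/
  link_disjoint : ∀ {a b a' b' : W} (h : H.Adj a b) (h' : H.Adj a' b'), s(a, b) ≠ s(a', b') →
    ∀ x, x ∈ (link h).support → x ∈ (link h').support → x ∈ Set.range branch
  /-- `S` has no further vertices. -/
  vertex_cover : ∀ x : U, x ∈ Set.range branch ∨
    ∃ (a b : W) (h : H.Adj a b), x ∈ (link h).support
  /-- `S` has no further edges. -/
  edge_cover : ∀ e ∈ S.edgeSet, ∃ (a b : W) (h : H.Adj a b), e ∈ (link h).edges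

/-- The graph `S` is an `H`-subdivision. -/
def IsSubdivisionOf {W U : Type*} (S : SimpleGraph U) (H : SimpleGraph W) : Prop :=
  Nonempty (SubdivisionModel H S)

/-- `G` contains a bipartite `H`-subdivision: some subgraph of `G` is an `H`-subdivision and is
a bipartite graph. -/
def ContainsBipartiteSubdivision {V W : Type*} (G : SimpleGraph V) (H : SimpleGraph W) : Prop :=
  ∃ S : G.Subgraph, S.coe.IsSubdivisionOf H ∧ S.coe.IsBipartite

/-- `G` is `k`-colorable with defect `d`: its vertices can be colored with `k` colors so that every
color class induces a subgraph in which all degrees are at most `d`. -/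
def ColorableWithDefect {V : Type*} (G : SimpleGraph V) (k d : ℕ) : Prop :=
  ∃ α : V → Fin k, ∀ (i : Fin k) (v : α ⁻¹' {i}),
    ((G.induce (α ⁻¹' {i})).neighborSet v).encard ≤ d

end SimpleGraph

/-! Write ℓ for `lightBound s t`. Every subgraph with an edge has a non-isolated vertex of degree
less than s or an edge whose two ends have degree at most ℓ (`exists_light_edge`). Remove the edges
at such a vertex, or such a light edge, and color what is left. A vertex of degree below s can then
take a color absent from its neighbors, and a restored light edge affects only vertices of total
degree at most ℓ (`exists_defective_coloring`). So defect ℓ suffices.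

For the light edge, suppose all non-isolated degrees are at least s and no light edge exists. Let A
be the vertices of degree above ℓ and B the other non-isolated ones; then every neighborhood of a
vertex of B lies in A. With κ = `hubDensity`, a Mader-type argument (`exists_hubs`) bounds the
density of G, so B is much larger than A. Greedily let vertices of B represent distinct pairs of
their neighbors, and let J be the graph of these pairs on A. Its edges are paths of length two in
the bipartite graph between A and its complement, so J is sparse too (`pairCount_lt_of_subdivided`),
and few vertices of B are used. The neighborhood of each unused vertex of B is a clique of J. Sparse
graphs have linearly many cliques (`card_le_of_clique_family`), so more than t unused vertices share
a neighborhood Q with at least s elements. Then Q, these vertices and the representatives of the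
pairs in Q contain the bipartite subdivision. -/

namespace SimpleGraph

/-! ### Links inside vertex sets and the assembly of subdivisions -/

/-- Two vertices are linked in `U` if some walk between them stays inside `U`. -/
def LinkedIn {V : Type*} (G : SimpleGraph V) (U : Set V) (x y : V) : Prop :=
  ∃ p : G.Walk x y, ∀ z ∈ p.support, z ∈ U

namespace LinkedIn

variable {V : Type*} {G : SimpleGraph V} {U U' : Set V} {x y z : V}

theorem refl (hx : x ∈ U) : G.LinkedIn U x x :=
  ⟨.nil, by simpa using hx⟩

theorem symm (h : G.LinkedIn U x y) : G.LinkedIn U y x := by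
  obtain ⟨p, hp⟩ := h
  exact ⟨p.reverse, by simpa using hp⟩

theorem trans (h : G.LinkedIn U x y) (h' : G.LinkedIn U y z) : G.LinkedIn U x z := by
  obtain ⟨p, hp⟩ := h
  obtain ⟨q, hq⟩ := h'
  refine ⟨p.append q, fun w hw => ?_⟩
  rcases (Walk.mem_support_append_iff _ _).1 hw with hw | hw
  exacts [hp w hw, hq w hw]

theorem mono (h : G.LinkedIn U x y) (hU : U ⊆ U') : G.LinkedIn U' x y := by
  obtain ⟨p, hp⟩ := h
  exact ⟨p, fun z hz => hU (hp z hz)⟩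

theorem of_adj (h : G.Adj x y) (hx : x ∈ U) (hy : y ∈ U) : G.LinkedIn U x y :=
  ⟨h.toWalk, by simp [hx, hy]⟩

/-- Linkedness is transported along a relation that turns each edge into a link. -/
theorem transport {G' : SimpleGraph V} (h : G.LinkedIn U x y) (hU : U ⊆ U')
    (hG : ∀ a ∈ U, ∀ b ∈ U, G.Adj a b → G'.LinkedIn U' a b) : G'.LinkedIn U' x y := by
  obtain ⟨p, hp⟩ := h
  induction p with
  | nil => exact refl (hU (hp _ (by simp)))
  | cons hadj p ih =>
    exact (hG _ (hp _ (by simp)) _ (hp _ (by simp)) hadj).trans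
      (ih fun z hz => hp z (by simp [hz]))

end LinkedIn

theorem Subgraph.exists_walk_coe {V : Type*} {G : SimpleGraph V} (S : G.Subgraph) {u v : V}
    (p : G.Walk u v) (hu : u ∈ S.verts) (hv : v ∈ S.verts)
    (h : ∀ x y, s(x, y) ∈ p.edges → S.Adj x y) :
    ∃ q : S.coe.Walk ⟨u, hu⟩ ⟨v, hv⟩, q.map S.hom = p := by
  induction p with
  | nil => exact ⟨.nil, rfl⟩
  | @cons u w v hadj p ih =>
    have hS : S.Adj u w := h u w (by simp)
    obtain ⟨q, hq⟩ := ih (S.edge_vert hS.symm) hv fun x y hxy => h x y (by simp [hxy])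
    have hS' : S.coe.Adj ⟨u, hu⟩ ⟨w, S.edge_vert hS.symm⟩ := hS
    exact ⟨.cons hS' q, congrArg (Walk.cons hadj) hq⟩

/-- A well-order on the vertices of H selects one orientation of each edge; a path is chosen for
that one and reversed for the other, which gives the symmetry that `SubdivisionModel` requires. -/
theorem exists_symmetric_paths {V W : Type*} {G : SimpleGraph V} {H : SimpleGraph W}
    (f : W → V) (U : Sym2 W → Set V)
    (hlink : ∀ a b, H.Adj a b → G.LinkedIn (U s(a, b) ∪ {f a, f b}) (f a) (f b)) :
    ∃ p : ∀ {a b : W}, H.Adj a b → G.Walk (f a) (f b),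
      (∀ {a b : W} (h : H.Adj a b), (p h).IsPath) ∧
      (∀ {a b : W} (h : H.Adj a b), p h.symm = (p h).reverse) ∧
      ∀ {a b : W} (h : H.Adj a b), ∀ z ∈ (p h).support, z ∈ U s(a, b) ∪ {f a, f b} := by
  classical
  let _ : LinearOrder W := linearOrderOfSTO WellOrderingRel
  have key : ∀ a b, H.Adj a b → ∃ p : G.Walk (f a) (f b), p.IsPath ∧
      ∀ z ∈ p.support, z ∈ U s(a, b) ∪ {f a, f b} := by
    intro a b h
    obtain ⟨p, hp⟩ := hlink a b h
    exact ⟨p.bypass, p.bypass_isPath, fun z hz => hp z (p.support_bypass_subset_support hz)⟩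
  choose p hpath hsupp using key
  refine ⟨fun {a b} h => if a < b then p a b h else (p b a h.symm).reverse, ?_, ?_, ?_⟩
  · intro a b h
    dsimp only
    split_ifs
    exacts [hpath _ _ _, (hpath _ _ _).reverse]
  · intro a b h
    dsimp only
    rcases lt_or_gt_of_ne h.ne with hab | hab
    · rw [if_neg hab.not_gt, if_pos hab]
    · rw [if_pos hab, if_neg hab.not_gt, Walk.reverse_reverse]
  · intro a b h z hz
    dsimp only at hz
    split_ifs at hz
    · exact hsupp _ _ _ z hz
    · have := hsupp _ _ h.symm z (by simpa using hz)
      rwa [Sym2.eq_swap, Set.pair_comm] at this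

/-- A bipartite subgraph in which the ends of every edge of `H` can be linked through pairwise
disjoint sets of non-branch vertices yields a bipartite `H`-subdivision. -/
theorem containsBipartiteSubdivision_of_linkedIn {V W : Type*} {G G' : SimpleGraph V}
    (hle : G' ≤ G) (hbip : G'.IsBipartite) {H : SimpleGraph W} (f : W ↪ V) (U : Sym2 W → Set V)
    (hf : ∀ e c, f c ∉ U e) (hU : ∀ e e' x, x ∈ U e → x ∈ U e' → e = e')
    (hlink : ∀ a b, H.Adj a b → G'.LinkedIn (U s(a, b) ∪ {f a, f b}) (f a) (f b)) :
    G.ContainsBipartiteSubdivision H := by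
  obtain ⟨p, hpath, hsymm, hsupp⟩ := exists_symmetric_paths f U hlink
  let S : G'.Subgraph :=
    { verts := {x | x ∈ Set.range f ∨ ∃ (a b : W) (h : H.Adj a b), x ∈ (p h).support}
      Adj := fun x y => ∃ (a b : W) (h : H.Adj a b), s(x, y) ∈ (p h).edges
      adj_sub := by
        rintro x y ⟨a, b, h, he⟩
        exact (p h).adj_of_mem_edges he
      edge_vert := by
        rintro x y ⟨a, b, h, he⟩
        exact Or.inr ⟨a, b, h, (p h).fst_mem_support_of_mem_edges he⟩
      symm := ⟨by
        rintro x y ⟨a, b, h, he⟩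
        exact ⟨a, b, h, by rwa [Sym2.eq_swap]⟩⟩ }
  have hfS : ∀ a, f a ∈ S.verts := fun a => Or.inl ⟨a, rfl⟩
  have hq : ∀ a b (h : H.Adj a b), ∃ q : S.coe.Walk ⟨f a, hfS a⟩ ⟨f b, hfS b⟩,
      q.map S.hom = p h := fun a b h =>
    S.exists_walk_coe (p h) (hfS a) (hfS b) fun x y hxy => ⟨a, b, h, hxy⟩
  choose q hq using hq
  have hqs : ∀ a b (h : H.Adj a b) (x : S.verts), x ∈ (q a b h).support ↔ x.1 ∈ (p h).support := by
    intro a b h x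
    have e : ((q a b h).map S.hom).support = (p h).support := congrArg Walk.support (hq a b h)
    rw [← e, Walk.support_map]
    exact (List.mem_map_of_injective S.hom_injective (a := x)).symm
  let M : SubdivisionModel H S.coe :=
    { branch := ⟨fun a => ⟨f a, hfS a⟩, fun a b hab => f.injective (congrArg Subtype.val hab)⟩
      link := fun {a b} h => q a b h
      link_isPath := fun {a b} h => by
        have := hpath h
        rw [← hq a b h] at this
        exact Walk.IsPath.of_map this
      link_symm := fun {a b} h => by
        apply Walk.map_injective_of_injective S.hom_injective
        have e : (q b a h.symm).map S.hom = ((q a b h).map S.hom).reverse :=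
          (hq b a h.symm).trans ((hsymm h).trans (congrArg Walk.reverse (hq a b h).symm))
        rw [e, Walk.reverse_map]
      branch_mem_link := fun {a b} h c hc => by
        have hc' := hsupp h _ ((hqs a b h _).1 hc)
        rcases hc' with hc' | hc' | hc'
        · exact absurd hc' (hf _ c)
        · exact Or.inl (f.injective hc')
        · exact Or.inr (f.injective hc')
      link_disjoint := fun {a b a' b'} h h' hne x hx hx' => by
        have h1 := hsupp h _ ((hqs a b h x).1 hx)
        have h2 := hsupp h' _ ((hqs a' b' h' x).1 hx')
        rcases h1 with h1 | h1 | h1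
        · rcases h2 with h2 | h2 | h2
          · exact absurd (hU _ _ _ h1 h2) hne
          · exact ⟨a', Subtype.ext h2.symm⟩
          · exact ⟨b', Subtype.ext h2.symm⟩
        · exact ⟨a, Subtype.ext h1.symm⟩
        · exact ⟨b, Subtype.ext h1.symm⟩
      vertex_cover := fun x => by
        rcases x.2 with ⟨a, ha⟩ | ⟨a, b, h, hx⟩
        · exact Or.inl ⟨a, Subtype.ext ha⟩
        · exact Or.inr ⟨a, b, h, (hqs a b h x).2 hx⟩
      edge_cover := fun e he => by
        induction e with
        | _ x y =>
          obtain ⟨a, b, h, hxy⟩ : S.Adj x.1 y.1 := he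
          refine ⟨a, b, h, ?_⟩
          have e : ((q a b h).map S.hom).edges = (p h).edges := congrArg Walk.edges (hq a b h)
          rw [← e, Walk.edges_map] at hxy
          exact (List.mem_map_of_injective (Sym2.map.injective S.hom_injective)
            (a := s(x, y))).1 hxy }
  let S' : G.Subgraph :=
    { verts := S.verts
      Adj := S.Adj
      adj_sub := fun h => hle (S.adj_sub h)
      edge_vert := fun h => S.edge_vert h
      symm := S.symm }
  exact ⟨S', ⟨M⟩, Colorable.of_hom S.hom hbip⟩

end SimpleGraph

/-! ### Density, bipartite cuts and hubs -/

namespace SimpleGraph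

open Finset Classical in
/-- The number of ordered pairs of adjacent vertices of `X`, i.e. twice the number of edges
inside `X`. -/
noncomputable def pairCount {V : Type*} (G : SimpleGraph V) (X : Finset V) : ℕ :=
  ∑ v ∈ X, #{w ∈ X | G.Adj v w}

section

open Finset Classical

variable {V : Type*} {G : SimpleGraph V}

theorem pairCount_insert {X : Finset V} {w : V} (hw : w ∉ X) :
    G.pairCount (insert w X) = G.pairCount X + 2 * #{x ∈ X | G.Adj w x} := by
  have h1 : ∀ v ∈ X, #{x ∈ insert w X | G.Adj v x} =
      #{x ∈ X | G.Adj v x} + if G.Adj w v then 1 else 0 := by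
    intro v _
    rw [filter_insert]
    by_cases h : G.Adj v w
    · rw [if_pos h, if_pos h.symm, card_insert_of_notMem (by simp [hw])]
    · rw [if_neg h, if_neg fun h' => h h'.symm, add_zero]
  have h2 : #{x ∈ insert w X | G.Adj w x} = #{x ∈ X | G.Adj w x} := by
    rw [filter_insert, if_neg G.irrefl]
  rw [pairCount, sum_insert hw, sum_congr rfl h1, sum_add_distrib, h2, ← card_filter, pairCount]
  ring

theorem pairCount_le_sq (X : Finset V) : G.pairCount X ≤ #X * #X := by
  rw [pairCount, ← smul_eq_mul]
  exact sum_le_card_nsmul _ _ _ fun v _ => card_filter_le _ _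

/-- Greedy max-cut: each new vertex joins the side that cuts at least half of its edges to the
earlier vertices. This makes bipartiteness cost only a factor 2 in density. -/
theorem exists_cut_pairCount (G : SimpleGraph V) (X : Finset V) :
    ∃ G' ≤ G, G'.IsBipartite ∧ G.pairCount X ≤ 2 * G'.pairCount X := by
  suffices h : ∃ (c : V → Bool) (G' : SimpleGraph V),
      (∀ v w, G'.Adj v w ↔ G.Adj v w ∧ c v ≠ c w) ∧ G.pairCount X ≤ 2 * G'.pairCount X by
    obtain ⟨c, G', hadj, hc⟩ := h
    refine ⟨G', fun v w h => ((hadj v w).1 h).1, ?_, hc⟩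
    have : G'.Coloring Bool := Coloring.mk c fun {v w} h => ((hadj v w).1 h).2
    exact this.colorable
  induction X using Finset.induction_on with
  | empty => exact ⟨fun _ => true, ⊥, by simp, by simp [pairCount]⟩
  | @insert w X hw ih =>
    obtain ⟨c, G', hadj, hc⟩ := ih
    have hsplit : #{x ∈ X | G.Adj w x} = #{x ∈ X | G.Adj w x ∧ true ≠ c x} +
        #{x ∈ X | G.Adj w x ∧ false ≠ c x} := by
      rw [← card_union_of_disjoint]
      · congr 1
        ext x
        cases h : c x <;> simp [h]
      · rw [Finset.disjoint_left]
        intro x h1 h2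
        cases h : c x <;> simp [h] at h1 h2
    obtain ⟨b, hb⟩ : ∃ b, #{x ∈ X | G.Adj w x} ≤ 2 * #{x ∈ X | G.Adj w x ∧ b ≠ c x} := by
      by_contra! hcon
      have h1 := hcon true
      have h2 := hcon false
      omega
    obtain ⟨G'', hadj'⟩ : ∃ G'' : SimpleGraph V, ∀ v x, G''.Adj v x ↔
        G.Adj v x ∧ Function.update c w b v ≠ Function.update c w b x :=
      ⟨G ⊓ (⊤ : SimpleGraph Bool).comap (Function.update c w b), fun v x => Iff.rfl⟩
    refine ⟨Function.update c w b, G'', hadj', ?_⟩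
    have hne : ∀ x ∈ X, x ≠ w := fun x hx h => hw (h ▸ hx)
    have e1 : G''.pairCount X = G'.pairCount X := by
      unfold pairCount
      refine sum_congr rfl fun v hv => ?_
      congr 1
      refine filter_congr fun x hx => ?_
      rw [hadj, hadj', Function.update_of_ne (hne x hx), Function.update_of_ne (hne v hv)]
    have e2 : #{x ∈ X | G''.Adj w x} = #{x ∈ X | G.Adj w x ∧ b ≠ c x} := by
      congr 1
      refine filter_congr fun x hx => ?_
      rw [hadj', Function.update_of_ne (hne x hx), Function.update_self]
    rw [pairCount_insert hw, pairCount_insert hw, e1, e2]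
    omega

/-- A set of vertices that is connected from within. -/
def LinkedSet (G : SimpleGraph V) (U : Set V) : Prop :=
  ∀ x ∈ U, ∀ y ∈ U, G.LinkedIn U x y

theorem LinkedSet.insert {U : Set V} (hU : G.LinkedSet U) {w u : V} (hu : u ∈ U)
    (h : G.Adj w u) : G.LinkedSet (insert w U) := by
  have key : ∀ x ∈ Insert.insert w U, G.LinkedIn (Insert.insert w U) x u := by
    rintro x (rfl | hx)
    · exact .of_adj h (by simp) (by simp [hu])
    · exact (hU x hx u hu).mono (Set.subset_insert _ _)
  exact fun x hx y hy => (key x hx).trans (key y hy).symm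

/-- A dense graph has a connected set of vertices with a dense piece of its neighbourhood. -/
theorem exists_linkedSet_dense_neighbors {k : ℕ} (hk : 0 < k) (X : Finset V) (hX : X.Nonempty)
    (h : 2 * k * #X ≤ G.pairCount X) :
    ∃ U ⊆ X, ∃ M ⊆ X, Disjoint U M ∧ M.Nonempty ∧ k * #M ≤ G.pairCount M ∧
      G.LinkedSet (U : Set V) ∧ ∀ v ∈ M, ∃ u ∈ U, G.Adj v u := by
  induction X using Finset.strongInduction with
  | H X ih =>
  -- A set U is good if contracting it to one vertex keeps the density: the contracted graph has
  -- `#(X \ U) + 1` vertices, and the neighbors `N U` account for the edges at the new vertex.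
  let N : Finset V → Finset V := fun U => {w ∈ X \ U | ∃ u ∈ U, G.Adj w u}
  let good : Finset (Finset V) := {U ∈ X.powerset | U.Nonempty ∧ G.LinkedSet (U : Set V) ∧
    2 * k * (#(X \ U) + 1) ≤ G.pairCount (X \ U) + 2 * #(N U)}
  have hgood : good.Nonempty := by
    obtain ⟨v, hv⟩ := hX
    refine ⟨{v}, ?_⟩
    have hN : N {v} = {x ∈ X \ {v} | G.Adj v x} := by
      refine filter_congr fun x _ => ?_
      simp [G.adj_comm]
    have hins : insert v (X \ {v}) = X := by
      rw [← erase_eq, insert_erase hv]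
    have hc : #(X \ {v}) + 1 = #X := by
      rw [← erase_eq, card_erase_add_one hv]
    simp only [good, mem_filter, mem_powerset, singleton_subset_iff]
    refine ⟨hv, ⟨v, by simp⟩, ?_, ?_⟩
    · intro x hx y hy
      simp only [coe_singleton, Set.mem_singleton_iff] at hx hy
      subst hx hy
      exact .refl (by simp)
    · rw [hN, hc, ← pairCount_insert (by simp), hins]
      exact h
  obtain ⟨U, hUgood, hmax⟩ := good.exists_max_image card hgood
  simp only [good, mem_filter, mem_powerset] at hUgood
  obtain ⟨hUX, hUne, hUlink, hUcount⟩ := hUgood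
  by_cases hN : (N U).Nonempty
  · refine ⟨U, hUX, N U, (filter_subset _ _).trans sdiff_subset, ?_, hN, ?_, hUlink, ?_⟩
    · rw [Finset.disjoint_left]
      intro x hx hx'
      simp only [N, mem_filter, mem_sdiff] at hx'
      exact hx'.1.2 hx
    · rw [pairCount, mul_comm, ← smul_eq_mul]
      refine card_nsmul_le_sum _ _ _ fun w hw => ?_
      have hw' := hw
      simp only [N, mem_filter, mem_sdiff] at hw'
      obtain ⟨⟨hwX, hwU⟩, u, hu, hwu⟩ := hw'
      -- Contracting w into a maximal U loses one vertex, and one edge plus one for each common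
      -- neighbor of w and U. As the density bound then fails, w has at least k neighbors inside `N
      -- U`.
      have hnot : insert w U ∉ good := by
        intro hmem
        have := hmax _ hmem
        rw [card_insert_of_notMem hwU] at this
        omega
      have hlt : G.pairCount (X \ insert w U) + 2 * #(N (insert w U)) <
          2 * k * (#(X \ insert w U) + 1) := by
        by_contra! hcon
        refine hnot ?_
        simp only [good, mem_filter, mem_powerset]
        refine ⟨insert_subset hwX hUX, insert_nonempty _ _, ?_, hcon⟩
        rw [coe_insert]
        exact hUlink.insert (mem_coe.2 hu) hwu
      set Y := X \ insert w U with hY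
      have hwY : w ∉ Y := by simp [hY]
      have hXU : X \ U = insert w Y := by
        ext x
        simp only [hY, mem_sdiff, mem_insert]
        by_cases hx : x = w
        · subst hx
          simp [hwX, hwU]
        · simp [hx]
      have hNins : N (insert w U) = (N U).erase w ∪ {x ∈ Y | G.Adj w x} := by
        ext x
        simp only [N, hY, mem_filter, mem_sdiff, mem_insert, mem_union, mem_erase]
        by_cases hx : x = w
        · simp [hx]
        · simp only [exists_eq_or_imp, G.adj_comm x w, hx, false_or, not_false_eq_true, ne_eq,
            true_and]
          rw [and_or_left]
          exact or_comm
      have hinter : (N U).erase w ∩ {x ∈ Y | G.Adj w x} = {x ∈ N U | G.Adj w x} := by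
        ext x
        have : x = w → ¬ G.Adj w x := fun hx h => G.ne_of_adj h hx.symm
        simp only [N, hY, mem_filter, mem_sdiff, mem_insert, mem_inter, mem_erase]
        tauto
      have hcard := card_union_add_card_inter ((N U).erase w) {x ∈ Y | G.Adj w x}
      rw [← hNins, hinter] at hcard
      have her := card_erase_add_one hw
      rw [hXU, pairCount_insert hwY, card_insert_of_notMem hwY] at hUcount
      have : 2 * k * (#Y + 1 + 1) = 2 * k * (#Y + 1) + 2 * k := by ring
      omega
    · intro v hv
      simp only [N, mem_filter] at hv
      exact hv.2
  -- With no neighbor in X, U contributes no edge to the count, so `X \ U` is itself dense and the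
  -- induction applies.
  · rw [not_nonempty_iff_eq_empty] at hN
    rw [hN, card_empty] at hUcount
    have hne : (X \ U).Nonempty := by
      rw [nonempty_iff_ne_empty]
      intro h0
      rw [h0] at hUcount
      simp [pairCount] at hUcount
      omega
    have hss : X \ U ⊂ X := by
      refine sdiff_ssubset hUX hUne
    obtain ⟨U', hU', M, hM, hrest⟩ := ih _ hss hne (by nlinarith)
    exact ⟨U', hU'.trans sdiff_subset, M, hM.trans sdiff_subset, hrest⟩

/-- A sufficiently dense graph has many vertices all attached to each of many disjoint connected
sets. -/
theorem exists_hubs {n : ℕ} (hn : 0 < n) (m : ℕ) (X : Finset V) (hX : X.Nonempty)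
    (h : 2 ^ m * n * #X ≤ G.pairCount X) :
    ∃ M ⊆ X, n ≤ #M ∧ ∃ U : Fin m → Finset V, (∀ i, U i ⊆ X) ∧ (∀ i, Disjoint (U i) M) ∧
      (∀ i j, i ≠ j → Disjoint (U i) (U j)) ∧ (∀ i, G.LinkedSet (U i : Set V)) ∧
      ∀ i, ∀ v ∈ M, ∃ u ∈ U i, G.Adj v u := by
  induction m generalizing X with
  | zero =>
    refine ⟨X, subset_rfl, ?_, Fin.elim0, by simp, by simp, by simp, by simp, by simp⟩
    have := h.trans (pairCount_le_sq X)
    rw [pow_zero, one_mul] at this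
    exact Nat.le_of_mul_le_mul_right this hX.card_pos
  | succ m ih =>
    obtain ⟨U₀, hU₀, X', hX', hdisj, hne, hcount, hlink, hadj⟩ :=
      exists_linkedSet_dense_neighbors (G := G) (k := 2 ^ m * n) (by positivity) X hX
        (by rw [pow_succ] at h; linarith)
    -- Each round halves the density and passes to the neighborhood of the new connected set, so
    -- this set stays attached to everything found later.
    obtain ⟨M, hM, hMn, U, hUX, hUM, hUU, hUl, hUa⟩ := ih X' hne hcount
    refine ⟨M, hM.trans hX', hMn, Fin.cons U₀ U, ?_, ?_, ?_, ?_, ?_⟩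
    · exact Fin.cases hU₀ fun i => (hUX i).trans hX'
    · exact Fin.cases (disjoint_of_subset_right hM hdisj) hUM
    · refine Fin.cases (Fin.cases (by simp) fun j _ => ?_) fun i => Fin.cases (fun _ => ?_)
        fun j hij => ?_
      · exact disjoint_of_subset_right (hUX j) hdisj
      · exact (disjoint_of_subset_right (hUX i) hdisj).symm
      · exact hUU i j (by simpa using hij)
    · exact Fin.cases hlink hUl
    · exact Fin.cases (fun v hv => hadj v (hM hv)) hUa

end

end SimpleGraph

/-! ### Sparsity forced by the absence of a bipartite subdivision -/

namespace SimpleGraph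

section

open Finset Classical

variable {V W : Type*} {G G' : SimpleGraph V} {H : SimpleGraph W} [Fintype W]

/-- Any vertices of M can be the branch vertices: each pair e has its own connected set `U e`,
attached to all of M, through which the two ends are linked. -/
theorem containsBipartiteSubdivision_of_hubs (hle : G' ≤ G) (hbip : G'.IsBipartite)
    (M : Finset V) (hM : Fintype.card W ≤ #M) (U : Sym2 W → Set V)
    (hUM : ∀ e, ∀ v ∈ M, v ∉ U e) (hU : ∀ e e' x, x ∈ U e → x ∈ U e' → e = e')
    (hlink : ∀ e, G'.LinkedSet (U e)) (hadj : ∀ e, ∀ v ∈ M, ∃ u ∈ U e, G'.Adj v u) :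
    G.ContainsBipartiteSubdivision H := by
  obtain ⟨g⟩ := Function.Embedding.nonempty_of_card_le (α := W) (β := M) (by simpa using hM)
  refine containsBipartiteSubdivision_of_linkedIn hle hbip
    (g.trans (Function.Embedding.subtype _)) U (fun e c => hUM e _ (g c).2) hU fun a b _ => ?_
  obtain ⟨u, hu, hau⟩ := hadj s(a, b) _ (g a).2
  obtain ⟨w, hw, hbw⟩ := hadj s(a, b) _ (g b).2
  have h1 := (hlink s(a, b) u hu w hw).mono
    (Set.subset_union_left (t := {(g a : V), (g b : V)}))
  exact ((LinkedIn.of_adj hau (by simp) (.inl hu)).trans h1).trans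
    (.of_adj hbw.symm (.inl hw) (by simp))

/-- The density that forces enough hubs for a subdivision of a graph with vertex set `W`. -/
def hubDensity (W : Type*) [Fintype W] : ℕ :=
  2 ^ Fintype.card (Sym2 W) * Fintype.card W

theorem exists_indexed_hubs [Nonempty W] (X : Finset V) (hX : X.Nonempty)
    (h : hubDensity W * #X ≤ G.pairCount X) :
    ∃ M ⊆ X, Fintype.card W ≤ #M ∧ ∃ U : Sym2 W → Finset V, (∀ e, U e ⊆ X) ∧
      (∀ e, Disjoint (U e) M) ∧ (∀ e e', e ≠ e' → Disjoint (U e) (U e')) ∧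
      (∀ e, G.LinkedSet (U e : Set V)) ∧ ∀ e, ∀ v ∈ M, ∃ u ∈ U e, G.Adj v u := by
  obtain ⟨M, hM, hn, U, h1, h2, h3, h4, h5⟩ := exists_hubs Fintype.card_pos _ X hX h
  let σ := Fintype.equivFin (Sym2 W)
  exact ⟨M, hM, hn, fun e => U (σ e), fun e => h1 _, fun e => h2 _,
    fun e e' he => h3 _ _ fun h => he (σ.injective h), fun e => h4 _, fun e => h5 _⟩

/-- The factor 2 pays for passing to a bipartite cut before hubs are sought. -/
theorem pairCount_lt_of_not_containsBipartiteSubdivision [Nonempty W]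
    (hG : ¬ G.ContainsBipartiteSubdivision H) (X : Finset V) (hX : X.Nonempty) :
    G.pairCount X < 2 * (hubDensity W * #X) := by
  by_contra! hcon
  obtain ⟨G', hle, hbip, hcut⟩ := exists_cut_pairCount G X
  obtain ⟨M, -, hn, U, -, h2, h3, h4, h5⟩ :=
    exists_indexed_hubs (G := G') (W := W) X hX (by omega)
  refine hG (containsBipartiteSubdivision_of_hubs hle hbip M hn (fun e => (U e : Set V))
    (fun e v hv hvU => Finset.disjoint_left.1 (h2 e) hvU hv) (fun e e' x hx hx' => ?_) h4 h5)
  by_contra hne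
  exact Finset.disjoint_left.1 (h3 e e' hne) hx hx'

/-- The density bound for a graph all of whose edges are represented by paths of length two
through distinct vertices outside `A`. -/
theorem pairCount_lt_of_subdivided [Nonempty W] (hG : ¬ G.ContainsBipartiteSubdivision H)
    (hle : G' ≤ G) (hbip : G'.IsBipartite) {A : Set V} {R : V → Sym2 V → Prop}
    (hR : ∀ b e e', R b e → R b e' → e = e') (hRA : ∀ b e, R b e → b ∉ A)
    (hRadj : ∀ b e, R b e → ∀ x ∈ e, G'.Adj b x) {J : SimpleGraph V}
    (hJ : ∀ x y, J.Adj x y → ∃ b, R b s(x, y)) (X : Finset V) (hXA : (X : Set V) ⊆ A)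
    (hX : X.Nonempty) : J.pairCount X < hubDensity W * #X := by
  by_contra! hcon
  obtain ⟨M, hMX, hn, U, hUX, h2, h3, h4, h5⟩ :=
    exists_indexed_hubs (G := J) (W := W) X hX hcon
  have hdisj : ∀ e e' x, x ∈ U e → x ∈ U e' → e = e' := by
    intro e e' x hx hx'
    by_contra hne
    exact Finset.disjoint_left.1 (h3 e e' hne) hx hx'
  have hUM : ∀ e x, x ∈ U e → x ∉ M := fun e _ h => Finset.disjoint_left.1 (h2 e) h
  -- Hubs of J become hubs of `G'` once the midpoints of the J-edges from `U e` to `U e` or M are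
  -- added. A midpoint determines its J-edge, which has an end in `U e`, so these sets remain
  -- disjoint.
  let U' : Sym2 W → Set V := fun e =>
    {x | x ∈ U e ∨ ∃ u ∈ U e, ∃ w, (w ∈ U e ∨ w ∈ M) ∧ R x s(u, w)}
  refine hG (containsBipartiteSubdivision_of_hubs hle hbip M hn U' ?_ ?_ ?_ ?_)
  · rintro e v hv (hvU | ⟨u, -, w, -, hvR⟩)
    · exact hUM e v hvU hv
    · exact hRA _ _ hvR (hXA (hMX hv))
  · rintro e e' x (hx | ⟨u, hu, w, hw, hx⟩) (hx' | ⟨u', hu', w', hw', hx'⟩)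
    · exact hdisj e e' x hx hx'
    · exact absurd (hXA (hUX e hx)) (hRA _ _ hx')
    · exact absurd (hXA (hUX e' hx')) (hRA _ _ hx)
    · rcases Sym2.eq_iff.1 (hR _ _ _ hx hx') with ⟨rfl, -⟩ | ⟨rfl, -⟩
      · exact hdisj e e' u hu hu'
      · rcases hw' with hw' | hw'
        · exact hdisj e e' u hu hw'
        · exact absurd hw' (hUM e u hu)
  · intro e
    have hsub : (U e : Set V) ⊆ U' e := fun x hx => Or.inl hx
    have key : ∀ x ∈ U' e, ∃ u ∈ U e, G'.LinkedIn (U' e) x u := by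
      rintro x (hx | ⟨u, hu, w, hw, hx⟩)
      · exact ⟨x, hx, .refl (Or.inl hx)⟩
      · exact ⟨u, hu, .of_adj (hRadj _ _ hx u (by simp)) (Or.inr ⟨u, hu, w, hw, hx⟩) (Or.inl hu)⟩
    intro x hx y hy
    obtain ⟨u, hu, hxu⟩ := key x hx
    obtain ⟨w, hw, hyw⟩ := key y hy
    refine (hxu.trans ((h4 e u hu w hw).transport hsub fun a ha b hb hab => ?_)).trans hyw.symm
    obtain ⟨c, hc⟩ := hJ a b hab
    have hcU : c ∈ U' e := Or.inr ⟨a, ha, b, Or.inl hb, hc⟩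
    exact (LinkedIn.of_adj (hRadj _ _ hc a (by simp)).symm (hsub ha) hcU).trans
      (.of_adj (hRadj _ _ hc b (by simp)) hcU (hsub hb))
  · intro e v hv
    obtain ⟨u, hu, hvu⟩ := h5 e v hv
    obtain ⟨c, hc⟩ := hJ u v hvu.symm
    exact ⟨c, Or.inr ⟨u, hu, v, Or.inr hv, hc⟩, (hRadj _ _ hc v (by simp)).symm⟩

/-- In a degenerate graph there are only linearly many cliques, even counted with bounded
multiplicity. -/
theorem card_le_of_clique_family {J : SimpleGraph V} {K t : ℕ} {ι : Type*} (N : ι → Finset V)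
    (A : Finset V) (hJ : ∀ X ⊆ A, X.Nonempty → J.pairCount X < K * #X) (B : Finset ι)
    (hNA : ∀ b ∈ B, N b ⊆ A) (hN : ∀ b ∈ B, (N b).Nonempty)
    (hclique : ∀ b ∈ B, ∀ x ∈ N b, ∀ y ∈ N b, x ≠ y → J.Adj x y)
    (hfib : ∀ Q, #{b ∈ B | N b = Q} ≤ t) : #B ≤ 2 ^ K * t * #A := by
  induction A using Finset.strongInduction generalizing B with
  | H A ih =>
  rcases A.eq_empty_or_nonempty with rfl | hA
  · have : B = ∅ := eq_empty_of_forall_notMem fun b hb => by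
      obtain ⟨x, hx⟩ := hN b hb
      simpa using hNA b hb hx
    simp [this]
  -- A vertex v of degree less than K exists by averaging. The cliques through v lie in its closed
  -- neighborhood, which has at most K elements, so at most `t * 2 ^ K` members of the family
  -- contain v; then v is deleted.
  · obtain ⟨v, hv, hdeg⟩ : ∃ v ∈ A, #{w ∈ A | J.Adj v w} < K := by
      by_contra! hcon
      have h1 := hJ A subset_rfl hA
      have h2 := card_nsmul_le_sum A (fun v => #{w ∈ A | J.Adj v w}) K hcon
      rw [smul_eq_mul, mul_comm] at h2
      exact absurd h1 (not_lt.2 h2)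
    have hsplit := card_filter_add_card_filter_not (s := B) (fun b => v ∈ N b)
    have h1 : #{b ∈ B | v ∈ N b} ≤ t * 2 ^ K := by
      have hmaps : ∀ b ∈ ({b ∈ B | v ∈ N b} : Finset ι),
          N b ∈ (insert v {w ∈ A | J.Adj v w} : Finset V).powerset := by
        intro b hb
        rw [mem_filter] at hb
        rw [mem_powerset]
        intro x hx
        rw [mem_insert, mem_filter]
        by_cases hxv : x = v
        · exact Or.inl hxv
        · exact Or.inr ⟨hNA b hb.1 hx, hclique b hb.1 v hb.2 x hx (Ne.symm hxv)⟩
      refine (card_le_mul_card_image_of_maps_to hmaps t fun Q _ => ?_).trans ?_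
      · exact (card_le_card (filter_subset_filter _ (filter_subset _ _))).trans (hfib Q)
      · rw [card_powerset]
        have hle : #(insert v {w ∈ A | J.Adj v w} : Finset V) ≤ K :=
          (card_insert_le _ _).trans hdeg
        gcongr
        norm_num
    have h2 : #{b ∈ B | v ∉ N b} ≤ 2 ^ K * t * #(A.erase v) := by
      refine ih (A.erase v) (erase_ssubset hv) (fun X hX => hJ X (hX.trans (erase_subset _ _)))
        _ ?_ ?_ ?_ ?_
      · intro b hb
        rw [mem_filter] at hb
        exact fun x hx => mem_erase.2 ⟨fun h => hb.2 (h ▸ hx), hNA b hb.1 hx⟩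
      · exact fun b hb => hN b (mem_filter.1 hb).1
      · exact fun b hb => hclique b (mem_filter.1 hb).1
      · exact fun Q => (card_le_card (filter_subset_filter _ (filter_subset _ _))).trans (hfib Q)
    have h3 := card_erase_add_one hv
    calc #B = #{b ∈ B | v ∈ N b} + #{b ∈ B | v ∉ N b} := hsplit.symm
      _ ≤ t * 2 ^ K + 2 ^ K * t * #(A.erase v) := add_le_add h1 h2
      _ = 2 ^ K * t * (#(A.erase v) + 1) := by ring
      _ = 2 ^ K * t * #A := by rw [h3]

theorem card_le_pairCount {J : SimpleGraph V} {ι : Type*} (D : Finset ι) (e : ι → Sym2 V)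
    (he : Set.InjOn e D) (A : Finset V) (hA : ∀ d ∈ D, ∀ x ∈ e d, x ∈ A)
    (hJ : ∀ d ∈ D, e d ∈ J.edgeSet) : #D ≤ J.pairCount A := by
  have hpc : J.pairCount A = #{p ∈ A ×ˢ A | J.Adj p.1 p.2} := by
    rw [card_filter, sum_product]
    exact sum_congr rfl fun v _ => card_filter _ _
  rw [hpc]
  have hout : ∀ d, s((e d).out.1, (e d).out.2) = e d := fun d => Quot.out_eq (e d)
  refine card_le_card_of_injOn (fun d => (e d).out) (fun d hd => ?_) fun d hd d' hd' h => ?_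
  · have hadj : J.Adj (e d).out.1 (e d).out.2 := by
      rw [← mem_edgeSet, hout]
      exact hJ d hd
    simp only [coe_filter, mem_product, Set.mem_ofPred_eq]
    exact ⟨⟨hA d hd _ (Sym2.out_fst_mem _), hA d hd _ (Sym2.out_snd_mem _)⟩, hadj⟩
  · refine he hd hd' ?_
    rw [← hout d, ← hout d', show (e d).out = (e d').out from h]

end

end SimpleGraph

/-! ### Light edges -/

namespace SimpleGraph

section

open Finset Classical

variable {V : Type*}

/-- Greedily assign distinct pairs of neighbours to vertices of `B`, as long as possible. -/
theorem exists_maximal_pair_assignment (B : Finset V) (N : V → Finset V) :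
    ∃ D ⊆ B, ∃ e : V → Sym2 V, Set.InjOn e D ∧ (∀ d ∈ D, ¬ (e d).IsDiag) ∧
      (∀ d ∈ D, ∀ x ∈ e d, x ∈ N d) ∧
      ∀ b ∈ B, b ∉ D → ∀ x ∈ N b, ∀ y ∈ N b, x ≠ y → ∃ d ∈ D, e d = s(x, y) := by
  let F : Finset (Finset V) := {D ∈ B.powerset | ∃ e : V → Sym2 V, Set.InjOn e D ∧
    (∀ d ∈ D, ¬ (e d).IsDiag) ∧ ∀ d ∈ D, ∀ x ∈ e d, x ∈ N d}
  have hF : F.Nonempty := ⟨∅, mem_filter.2 ⟨by simp, fun v => s(v, v), by simp, by simp, by simp⟩⟩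
  obtain ⟨D, hD, hmax⟩ := F.exists_max_image card hF
  obtain ⟨hDB, e, hinj, hdiag, hmem⟩ := mem_filter.1 hD
  rw [mem_powerset] at hDB
  refine ⟨D, hDB, e, hinj, hdiag, hmem, fun b hb hbD x hx y hy hxy => ?_⟩
  -- An unrepresented pair x, y could be assigned to the unused b, against the maximality of D.
  by_contra! hcon
  have hne : ∀ d ∈ D, d ≠ b := fun d hd h => hbD (h ▸ hd)
  have hup : ∀ d ∈ D, Function.update e b s(x, y) d = e d := fun d hd =>
    Function.update_of_ne (hne d hd) _ _
  have hmem' : insert b D ∈ F := by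
    refine mem_filter.2 ⟨mem_powerset.2 (insert_subset hb hDB), Function.update e b s(x, y),
      ?_, ?_, ?_⟩
    · rw [coe_insert, Set.injOn_insert (by simpa using hbD)]
      refine ⟨hinj.congr fun d hd => (hup d hd).symm, ?_⟩
      rintro ⟨d, hd, h⟩
      rw [hup d hd, Function.update_self] at h
      exact hcon d hd h
    · intro d hd
      rcases mem_insert.1 hd with rfl | hd
      · simpa using hxy
      · rw [hup d hd]
        exact hdiag d hd
    · intro d hd
      rcases mem_insert.1 hd with rfl | hd
      · intro z hz
        rw [Function.update_self, Sym2.mem_iff] at hz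
        rcases hz with rfl | rfl
        exacts [hx, hy]
      · rw [hup d hd]
        exact hmem d hd
  have := hmax _ hmem'
  rw [card_insert_of_notMem hbD] at this
  omega

theorem completeJoinEmpty_adj_inl_inl {s t : ℕ} {i j : Fin s} :
    (completeJoinEmpty s t).Adj (.inl i) (.inl j) ↔ i ≠ j := by
  simp [completeJoinEmpty, joinGraph]

theorem not_completeJoinEmpty_adj_inr_inr {s t : ℕ} {i j : Fin t} :
    ¬ (completeJoinEmpty s t).Adj (.inr i) (.inr j) := by
  simp [completeJoinEmpty, joinGraph]

/-- The degree bound for the two ends of a light edge. -/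
def lightBound (s t : ℕ) : ℕ :=
  2 * hubDensity (Fin s ⊕ Fin t) *
    (hubDensity (Fin s ⊕ Fin t) + 2 ^ hubDensity (Fin s ⊕ Fin t) * t + 1)

/-- If every vertex of `Q` is adjacent to every vertex of `T`, and distinct pairs of vertices of `Q`
are joined by paths of length two through distinct vertices of `D`, then a bipartite subdivision of
`K_s + I_t` appears. -/
theorem containsBipartiteSubdivision_completeJoinEmpty {s t : ℕ} {G G' : SimpleGraph V}
    (hle : G' ≤ G) (hbip : G'.IsBipartite) {Q T D : Finset V} (hQ : s ≤ #Q) (hT : t ≤ #T)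
    (hQT : ∀ x ∈ Q, ∀ b ∈ T, G'.Adj x b) (hQD : ∀ x ∈ Q, x ∉ D) (hTD : ∀ b ∈ T, b ∉ D)
    {e : V → Sym2 V} (he : ∀ x ∈ Q, ∀ y ∈ Q, x ≠ y →
      ∃ d ∈ D, e d = s(x, y) ∧ G'.Adj d x ∧ G'.Adj d y) :
    G.ContainsBipartiteSubdivision (completeJoinEmpty s t) := by
  obtain ⟨g⟩ := Function.Embedding.nonempty_of_card_le (α := Fin s) (β := Q) (by simpa using hQ)
  obtain ⟨h⟩ := Function.Embedding.nonempty_of_card_le (α := Fin t) (β := T) (by simpa using hT)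
  let f : Fin s ⊕ Fin t → V := Sum.elim (fun i => g i) (fun j => h j)
  have hf : Function.Injective f := by
    refine Function.Injective.sumElim (Subtype.val_injective.comp g.injective)
      (Subtype.val_injective.comp h.injective) fun i j hij => ?_
    exact G'.ne_of_adj (hQT _ (g i).2 _ (h j).2) hij
  -- The inner vertices available to a pair are those of D assigned to its image; only edges inside
  -- the complete part need one, the others are direct edges of `G'`.
  refine containsBipartiteSubdivision_of_linkedIn hle hbip ⟨f, hf⟩
    (fun p => {b | b ∈ D ∧ e b = p.map f}) ?_ ?_ ?_
  · rintro p (i | j) ⟨hD, -⟩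
    exacts [hQD _ (g i).2 hD, hTD _ (h j).2 hD]
  · rintro p p' x ⟨-, hx⟩ ⟨-, hx'⟩
    exact Sym2.map.injective hf (hx.symm.trans hx')
  · rintro (i | j) (i' | j') hadj
    · have hne : (g i : V) ≠ g i' := fun h =>
        completeJoinEmpty_adj_inl_inl.1 hadj (g.injective (Subtype.ext h))
      obtain ⟨d, hd, hed, h1, h2⟩ := he _ (g i).2 _ (g i').2 hne
      exact (LinkedIn.of_adj h1.symm (by simp [f]) (.inl ⟨hd, hed⟩)).trans
        (.of_adj h2 (.inl ⟨hd, hed⟩) (by simp [f]))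
    · exact .of_adj (hQT _ (g i).2 _ (h j').2) (by simp [f]) (by simp [f])
    · exact .of_adj (hQT _ (g i').2 _ (h j).2).symm (by simp [f]) (by simp [f])
    · exact absurd hadj not_completeJoinEmpty_adj_inr_inr

/-- Without a light edge, the low-degree vertices send all their edges to high-degree ones and far
outnumber them; by pigeonhole on cliques, many then share one neighborhood. -/
theorem exists_light_edge {s t : ℕ} (hs : 0 < s) [Fintype V] {G : SimpleGraph V}
    (hG : ¬ G.ContainsBipartiteSubdivision (completeJoinEmpty s t)) (hne : G ≠ ⊥)
    (hdeg : ∀ v, #{w | G.Adj v w} ≠ 0 → s ≤ #{w | G.Adj v w}) :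
    ∃ x y, G.Adj x y ∧ #{w | G.Adj x w} ≤ lightBound s t ∧ #{w | G.Adj y w} ≤ lightBound s t := by
  by_contra! hheavy
  set κ := hubDensity (Fin s ⊕ Fin t) with hκ
  have : Nonempty (Fin s ⊕ Fin t) := ⟨.inl ⟨0, hs⟩⟩
  let N : V → Finset V := fun v => {w | G.Adj v w}
  have hN : ∀ v w, w ∈ N v ↔ G.Adj v w := by simp [N]
  let A : Finset V := {v | lightBound s t < #(N v)}
  let B : Finset V := {v | #(N v) ≠ 0 ∧ #(N v) ≤ lightBound s t}
  have hA : ∀ v, v ∈ A ↔ lightBound s t < #(N v) := by simp [A]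
  have hB : ∀ v, v ∈ B ↔ #(N v) ≠ 0 ∧ #(N v) ≤ lightBound s t := by simp [B]
  have hAB : ∀ v ∈ B, v ∉ A := fun v hv => by
    rw [hA, not_lt]
    exact ((hB v).1 hv).2
  have hNB : ∀ b ∈ B, N b ⊆ A := fun b hb x hx =>
    (hA x).2 (hheavy b x ((hN b x).1 hx) ((hB b).1 hb).2)
  obtain ⟨x₀, y₀, hxy₀⟩ := ne_bot_iff_exists_adj.1 hne
  have hA0 : A.Nonempty := by
    by_cases hx : lightBound s t < #(N x₀)
    · exact ⟨x₀, (hA _).2 hx⟩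
    · exact ⟨y₀, (hA _).2 (hheavy x₀ y₀ hxy₀ (not_lt.1 hx))⟩
  -- the vertices of `B` far outnumber those of `A`
  have hmany : (κ + 2 ^ κ * t) * #A < #B := by
    have h1 := pairCount_lt_of_not_containsBipartiteSubdivision hG (A ∪ B)
      (hA0.mono subset_union_left)
    rw [card_union_of_disjoint (Finset.disjoint_right.2 hAB), ← hκ] at h1
    have h2 : lightBound s t * #A ≤ G.pairCount (A ∪ B) := by
      calc lightBound s t * #A = #A • lightBound s t := by rw [smul_eq_mul, mul_comm]
        _ ≤ ∑ v ∈ A, #{w ∈ A ∪ B | G.Adj v w} := by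
          refine card_nsmul_le_sum _ _ _ fun v hv => ?_
          refine ((hA v).1 hv).le.trans (card_le_card fun w hw => ?_)
          have hw' := (hN v w).1 hw
          refine mem_filter.2 ⟨?_, hw'⟩
          rw [mem_union, hA, hB]
          have : #(N w) ≠ 0 := card_ne_zero_of_mem ((hN w v).2 hw'.symm)
          omega
        _ ≤ G.pairCount (A ∪ B) := sum_le_sum_of_subset subset_union_left
    -- Cancelling `2 * κ` is what fixes the form of `lightBound`: its term κ pays for D, its term `2
    -- ^ κ * t` for the clique count, and its 1 for the `#A` on the right.
    have h3 : 2 * κ * ((κ + 2 ^ κ * t + 1) * #A) < 2 * κ * (#A + #B) := by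
      calc _ = lightBound s t * #A := by rw [lightBound, ← hκ]; ring
        _ < _ := h2.trans_lt h1
        _ = _ := by ring
    have h4 := lt_of_mul_lt_mul_left h3 (Nat.zero_le _)
    rw [add_mul, one_mul] at h4
    omega
  -- Cutting along A itself keeps every edge at a vertex of B.
  obtain ⟨G', hG'⟩ : ∃ G' : SimpleGraph V, ∀ v w, G'.Adj v w ↔
      G.Adj v w ∧ decide (v ∈ A) ≠ decide (w ∈ A) :=
    ⟨G ⊓ (⊤ : SimpleGraph Bool).comap fun v => decide (v ∈ A), fun v w => Iff.rfl⟩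
  have hle : G' ≤ G := fun v w h => ((hG' v w).1 h).1
  have hbip : G'.IsBipartite := by
    have c : G'.Coloring Bool := Coloring.mk (fun v => decide (v ∈ A)) fun h => ((hG' _ _).1 h).2
    exact c.colorable
  have hadj' : ∀ b ∈ B, ∀ x ∈ N b, G'.Adj b x := fun b hb x hx =>
    (hG' b x).2 ⟨(hN b x).1 hx, by simp [hAB b hb, hNB b hb hx]⟩
  obtain ⟨D, hDB, e, hinj, hdiag, hmem, hmax⟩ := exists_maximal_pair_assignment B N
  let J : SimpleGraph V := fromEdgeSet {p | ∃ d ∈ D, e d = p}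
  have hJ : ∀ x y, J.Adj x y ↔ (∃ d ∈ D, e d = s(x, y)) ∧ x ≠ y := fun x y => by
    simp [J]
  have hsparse : ∀ X ⊆ A, X.Nonempty → J.pairCount X < κ * #X := by
    intro X hXA hX
    refine pairCount_lt_of_subdivided (A := A) (R := fun b p => b ∈ D ∧ e b = p) hG hle hbip
      ?_ ?_ ?_ ?_ X (by exact_mod_cast hXA) hX
    · rintro b p p' ⟨-, h⟩ ⟨-, h'⟩
      exact h.symm.trans h'
    · rintro b p ⟨hb, -⟩
      exact_mod_cast hAB b (hDB hb)
    · rintro b p ⟨hb, rfl⟩ x hx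
      exact hadj' b (hDB hb) x (hmem b hb x hx)
    · intro x y h
      obtain ⟨⟨d, hd, h⟩, -⟩ := (hJ x y).1 h
      exact ⟨d, hd, h⟩
  have hDcard : #D ≤ κ * #A := by
    refine (card_le_pairCount (J := J) D e hinj A
      (fun d hd x hx => hNB d (hDB hd) (hmem d hd x hx)) fun d hd => ?_).trans
      (hsparse A subset_rfl hA0).le
    rw [edgeSet_fromEdgeSet]
    exact ⟨⟨d, hd, rfl⟩, hdiag d hd⟩
  have hrest : 2 ^ κ * t * #A < #(B \ D) := by
    have := card_sdiff_add_card_eq_card hDB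
    rw [add_mul] at hmany
    omega
  obtain ⟨Q, hQ⟩ : ∃ Q, t < #{b ∈ B \ D | N b = Q} := by
    by_contra! hcon
    refine absurd (card_le_of_clique_family (J := J) N A hsparse (B \ D) ?_ ?_ ?_ hcon)
      (not_le.2 hrest)
    · exact fun b hb => hNB b (mem_sdiff.1 hb).1
    · exact fun b hb => card_ne_zero.1 ((hB b).1 (mem_sdiff.1 hb).1).1
    · intro b hb x hx y hy hxy
      rw [mem_sdiff] at hb
      exact (hJ x y).2 ⟨hmax b hb.1 hb.2 x hx y hy hxy, hxy⟩
  have hT : ∀ b ∈ ({b ∈ B \ D | N b = Q} : Finset V), b ∈ B ∧ b ∉ D ∧ N b = Q := fun b hb => by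
    simpa [and_assoc] using hb
  obtain ⟨b₀, hb₀⟩ := card_pos.1 (Nat.zero_lt_of_lt hQ)
  obtain ⟨hb₀B, hb₀D, rfl⟩ := hT b₀ hb₀
  refine hG (containsBipartiteSubdivision_completeJoinEmpty hle hbip (Q := N b₀) (D := D) (e := e)
    (hdeg b₀ ((hB b₀).1 hb₀B).1) hQ.le ?_ ?_ ?_ ?_)
  · intro x hx b hb
    obtain ⟨hbB, -, hbN⟩ := hT b hb
    exact (hadj' b hbB x (hbN ▸ hx)).symm
  · exact fun x hx hxD => hAB x (hDB hxD) (hNB b₀ hb₀B hx)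
  · exact fun b hb => (hT b hb).2.1
  · intro x hx y hy hxy
    obtain ⟨d, hd, hed⟩ := hmax b₀ hb₀B hb₀D x hx y hy hxy
    have hadjd := fun z hz => hadj' d (hDB hd) z (hmem d hd z hz)
    rw [hed] at hadjd
    exact ⟨d, hd, hed, hadjd x (by simp), hadjd y (by simp)⟩

/-! ### Defective coloring by successive removal -/

/-- Vertices of small degree and light edges can be removed one by one. -/
theorem exists_defective_coloring {s ℓ : ℕ} (hs : 0 < s) [Fintype V] (G : SimpleGraph V)
    (h : ∀ G' ≤ G, G' ≠ ⊥ → (∃ v, #{w | G'.Adj v w} ≠ 0 ∧ #{w | G'.Adj v w} < s) ∨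
      ∃ x y, G'.Adj x y ∧ #{w | G'.Adj x w} ≤ ℓ ∧ #{w | G'.Adj y w} ≤ ℓ) :
    ∃ α : V → Fin s, ∀ v, #{w | G.Adj v w ∧ α w = α v} ≤ ℓ := by
  induction G using WellFoundedLT.induction with
  | ind G ih =>
  rcases eq_or_ne G ⊥ with rfl | hne
  · exact ⟨fun _ => ⟨0, hs⟩, by simp⟩
  rcases h G le_rfl hne with ⟨v, hv0, hvs⟩ | ⟨x, y, hxy, hx, hy⟩
  · obtain ⟨G₁, hG₁⟩ : ∃ G₁ : SimpleGraph V, ∀ a b, G₁.Adj a b ↔ G.Adj a b ∧ a ≠ v ∧ b ≠ v :=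
      ⟨G.deleteIncidenceSet v, fun a b => deleteIncidenceSet_adj⟩
    have hle : G₁ ≤ G := fun a b h => ((hG₁ a b).1 h).1
    have hlt : G₁ < G := by
      refine lt_of_le_of_ne hle ?_
      rintro rfl
      obtain ⟨w, hw⟩ := card_ne_zero.1 hv0
      exact ((hG₁ v w).1 (by simpa using hw)).2.1 rfl
    obtain ⟨α, hα⟩ := ih G₁ hlt fun G' hG' => h G' (hG'.trans hle)
    -- Fewer than s neighbors leave a color free. Given to v, it creates no monochromatic edge at v,
    -- so no other vertex gains a neighbor of its own color.
    obtain ⟨c, hc⟩ : ∃ c, c ∉ image α {w | G.Adj v w} := by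
      by_contra! hcon
      have h1 := card_le_card (fun c _ => hcon c : (univ : Finset (Fin s)) ⊆ _)
      rw [card_univ, Fintype.card_fin] at h1
      exact absurd (h1.trans card_image_le) (not_le.2 hvs)
    have hc' : ∀ w, G.Adj v w → α w ≠ c := fun w hw h =>
      hc (mem_image.2 ⟨w, by simpa using hw, h⟩)
    refine ⟨Function.update α v c, fun u => ?_⟩
    by_cases hu : u = v
    · subst hu
      rw [filter_eq_empty_iff.2, card_empty]
      · exact Nat.zero_le _
      · rintro w - ⟨hw, hcw⟩
        rw [Function.update_self, Function.update_of_ne hw.ne'] at hcw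
        exact hc' w hw hcw
    · refine (card_le_card fun w hw => ?_).trans (hα u)
      simp only [mem_filter, mem_univ, true_and] at hw ⊢
      obtain ⟨hw, hcw⟩ := hw
      rw [Function.update_of_ne hu] at hcw
      have hwv : w ≠ v := by
        rintro rfl
        rw [Function.update_self] at hcw
        exact hc' u hw.symm hcw.symm
      rw [Function.update_of_ne hwv] at hcw
      exact ⟨(hG₁ u w).2 ⟨hw, hu, hwv⟩, hcw⟩
  · obtain ⟨G₁, hG₁⟩ : ∃ G₁ : SimpleGraph V, ∀ a b, G₁.Adj a b ↔ G.Adj a b ∧ s(a, b) ≠ s(x, y) :=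
      ⟨G.deleteEdges {s(x, y)}, fun a b => deleteEdges_adj⟩
    have hle : G₁ ≤ G := fun a b h => ((hG₁ a b).1 h).1
    have hlt : G₁ < G := by
      refine lt_of_le_of_ne hle ?_
      rintro rfl
      exact ((hG₁ x y).1 hxy).2 rfl
    obtain ⟨α, hα⟩ := ih G₁ hlt fun G' hG' => h G' (hG'.trans hle)
    refine ⟨α, fun u => ?_⟩
    -- For the ends x and y the total degree already suffices; at every other vertex the restored
    -- edge is invisible.
    have hmono : #{w | G.Adj u w ∧ α w = α u} ≤ #{w | G.Adj u w} :=
      card_le_card (monotone_filter_right _ fun w _ hw => hw.1)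
    by_cases hux : u = x
    · subst hux
      exact hmono.trans hx
    by_cases huy : u = y
    · subst huy
      exact hmono.trans hy
    refine (card_le_card fun w hw => ?_).trans (hα u)
    simp only [mem_filter, mem_univ, true_and] at hw ⊢
    refine ⟨(hG₁ u w).2 ⟨hw.1, fun h => ?_⟩, hw.2⟩
    rcases Sym2.eq_iff.1 h with ⟨h, -⟩ | ⟨h, -⟩
    exacts [hux h, huy h]

theorem ContainsBipartiteSubdivision.mono {W : Type*} {G G' : SimpleGraph V} {H : SimpleGraph W}
    (hle : G' ≤ G) (h : G'.ContainsBipartiteSubdivision H) :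
    G.ContainsBipartiteSubdivision H := by
  obtain ⟨S, hS, hbip⟩ := h
  let S' : G.Subgraph :=
    { verts := S.verts
      Adj := S.Adj
      adj_sub := fun h => hle (S.adj_sub h)
      edge_vert := fun h => S.edge_vert h
      symm := S.symm }
  exact ⟨S', hS, hbip⟩

theorem colorableWithDefect_of_card_le {k d : ℕ} [Fintype V] {G : SimpleGraph V} (α : V → Fin k)
    (hα : ∀ v, #{w | G.Adj v w ∧ α w = α v} ≤ d) : G.ColorableWithDefect k d := by
  refine ⟨α, fun i v => ?_⟩
  rw [← Subtype.val_injective.encard_image]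
  refine (Set.encard_le_encard (t := (({w | G.Adj v w ∧ α w = α v} : Finset V) : Set V)) ?_).trans ?_
  · rintro _ ⟨w, hw, rfl⟩
    simp only [coe_filter, mem_univ, true_and, Set.mem_ofPred_eq]
    exact ⟨hw, w.2.trans v.2.symm⟩
  · rw [Set.encard_coe_eq_coe_finsetCard]
    exact_mod_cast hα v

end

end SimpleGraph

theorem mainTheorem9 (s t : ℕ) (hs : 0 < s) (ht : 0 < t) :
    ∃ N : ℕ, ∀ (V : Type*) [Finite V] (G : SimpleGraph V),
      ¬ G.ContainsBipartiteSubdivision (SimpleGraph.completeJoinEmpty s t) →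
        G.ColorableWithDefect s N := by
  classical
  refine ⟨SimpleGraph.lightBound s t, fun V _ G hG => ?_⟩
  have := Fintype.ofFinite V
  obtain ⟨α, hα⟩ := SimpleGraph.exists_defective_coloring (ℓ := SimpleGraph.lightBound s t) hs G
    fun G' hle hne => by
      by_contra! hcon
      obtain ⟨x, y, hxy, hx, hy⟩ := SimpleGraph.exists_light_edge hs
        (fun h => hG (h.mono hle)) hne hcon.1
      exact absurd hy (not_le.2 (hcon.2 x y hxy hx))
  exact SimpleGraph.colorableWithDefect_of_card_le α hα
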